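/- Let $\Lambda$ be a finite or countably infinite set and let $P=(P(i,j))_{i,j\in\Lambda}$ be a stochastic matrix (nonnegative entries, $\sum_j P(i,j)=1$ for every $i$). Write $i\to j$ if $P^n(i,j)>0$ for some integer $n\ge 0$. The classical chain is irreducible if $i\to j$ for all $i,j\in\Lambda$, and reducible otherwise; a set $C\subset\Lambda$ is forward-closed if $i\in C$ and $i\to j$ imply $j\in C$. For arbitrary $U^i_j\in\mathbb C$ with $|U^i_j|=1$, encode $P$ as the open quantum random walk with internal space $\mathcal H=\mathbb C$ and $B^i_j=\sqrt{P(j,i)}\,U^i_j$. For a probability measure $\rho^{(0)}$ on $\Lambda$ (initial state), let $\rho^{(n)}=\mathcal M^n(\rho^{(0)})$, where $\mathcal M(\rho)_i=\sum_j B^i_j\rho_j (B^i_j)^*$. Let $\mathcal B=\ell^\infty(\Lambda)$. The transition expectations are the bilinear maps $$\mathcal E^{(n)}(x\otimes y)_j=\begin{cases}\dfrac{\rho^{(n)}_jx_j}{\rho^{(n)}_j}\displaystyle\sum_i (B^i_j)^*y_iB^i_j,&\rho^{(n)}_j\ne 0,\\[1ex] 0,&\rho^{(n)}_j=0,\end{cases}\qquad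 x,y\in\mathcal B,$$ that is, $\mathcal E^{(n)}(x\otimes y)=P_{\rho^{(n)}}\,x\,Py$, where $P_{\rho^{(n)}}$ is the indicator function of the support of $\rho^{(n)}$ and $(Py)_j=\sum_iP(j,i)y_i$. Let $\mathcal A=\bigotimes_{k\ge 0}\mathcal B$, realized as the algebra of bounded measurable functions on $\Lambda^{\mathbb N}$, in which $a_0\otimes\cdots\otimes a_n\otimes I\otimes\cdots$ is the function $\omega\mapsto\prod_{k\le n}a_k(\omega_k)$. Let $\bar b(n)=\lim_{k\to\infty}\mathcal E^{(n)}(I\otimes\mathcal E^{(n+1)}(I\otimes\cdots\otimes\mathcal E^{(n+k)}(I\otimes I)))$ (pointwise limit), and let $E_{0]}:\mathcal A\to\mathcal B$ be the unique positive linear map with $E_{0]}(I)\le I$ that is continuous along bounded pointwise convergent sequences and satisfies $$E_{0]}(a_0\otimes\cdots\otimes a_n\otimes I\otimes\cdots)=\mathcal E^{(0)}(a_0\otimes\mathcal E^{(1)}(a_1\otimes\cdots\otimes\mathcal E^{(n)}(a_n\otimes\bar b(n+1)))).$$ The pair $(\rho^{(0)},(\mathcal E^{(n)})_{n\ge0})$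 is a quantum Markov chain (QMC) if $E_{0]}$ exists and $\sum_i\rho^{(0)}_iE_{0]}(I)_i=1$. The QMC is reducible if there are a projection $p\in\mathcal B$ with $p\ne0,I$ and an $n_0\ge0$ such that $E_{0]}(p_{[n_0}\,a\,p_{[n_0})=E_{0]}(a)$ for all $a\in\mathcal A$, where $p_{[n_0}=I\otimes\cdots\otimes I\otimes p\otimes p\otimes\cdots$ has $p$ at every place $k\ge n_0$. **Proposition.** Suppose that the classical chain with transition matrix $P$ is reducible. Then there are a nonempty forward-closed set $C\subsetneq\Lambda$ and an initial probability measure $\rho^{(0)}$ supported on $C$ such that, for every choice of the phases $U^i_j$, the pair $(\rho^{(0)},(\mathcal E^{(n)})_{n\ge 0})$ is a QMC and is reducible. Moreover, this holds for every nonempty forward-closed set $C\subsetneq\Lambda$ (in particular for every closed communicating class $C$) and every initial probability measure $\rho^{(0)}$ supported on $C$. -/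

import Mathlib

open scoped ComplexOrder ENNReal ComplexConjugate Topology MeasureTheory

noncomputable section

namespace OQRW

/-! ### Classical Markov chains -/

/-- A stochastic matrix on the (countable) state space `Λ`. -/
structure StochasticMatrix (Λ : Type*) where
  P : Λ → Λ → ℝ
  nonneg : ∀ i j, 0 ≤ P i j
  hasSum_row : ∀ i, HasSum (fun j => P i j) 1

/-- The `n`-step transition probability `Pⁿ(i,j)`. -/
def StochasticMatrix.pow {Λ : Type*} (S : StochasticMatrix Λ) : ℕ → Λ → Λ → ℝ
  | 0 => fun i j => Set.indicator {i} 1 j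
  | n + 1 => fun i j => ∑' k, S.P i k * S.pow n k j

/-- `j` is accessible from `i`. -/
def StochasticMatrix.Accessible {Λ : Type*} (S : StochasticMatrix Λ) (i j : Λ) : Prop :=
  ∃ n : ℕ, 0 < S.pow n i j

/-- `i` and `j` communicate. -/
def StochasticMatrix.Communicates {Λ : Type*} (S : StochasticMatrix Λ) (i j : Λ) : Prop :=
  S.Accessible i j ∧ S.Accessible j i

/-- The classical chain is irreducible: any two states communicate. -/
def StochasticMatrix.Irreducible {Λ : Type*} (S : StochasticMatrix Λ) : Prop :=
  ∀ i j, S.Communicates i j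

/-- The classical chain is reducible: it is not irreducible. -/
def StochasticMatrix.Reducible {Λ : Type*} (S : StochasticMatrix Λ) : Prop :=
  ¬ S.Irreducible

/-- `C` is closed under the dynamics: every state accessible from `C` lies in `C`. -/
def StochasticMatrix.ForwardClosed {Λ : Type*} (S : StochasticMatrix Λ) (C : Set Λ) : Prop :=
  ∀ i ∈ C, ∀ j, S.Accessible i j → j ∈ C

/-! ### Open quantum random walks with `H = ℂ` -/

/-- An open quantum random walk on `Λ` whose internal space is `H = ℂ`; bounded operators on `H`
are complex numbers. `B i j` is the effect of passing from `j` to `i`. -/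
structure Walk (Λ : Type*) where
  B : Λ → Λ → ℂ
  hasSum_effects : ∀ j, HasSum (fun i => conj (B i j) * B i j) 1

/-- The walk that encodes a classical chain: `B i j = √P(j,i) · U i j`, with arbitrary phases
(unitary operators of `ℂ`) `U i j`. -/
def StochasticMatrix.toWalk {Λ : Type*} (S : StochasticMatrix Λ) (U : Λ → Λ → Circle) :
    Walk Λ where
  B i j := (Real.sqrt (S.P j i) : ℂ) * (U i j : ℂ)
  hasSum_effects j := by
    have h : (fun i => conj ((Real.sqrt (S.P j i) : ℂ) * (U i j : ℂ)) *
        ((Real.sqrt (S.P j i) : ℂ) * (U i j : ℂ))) = fun i => ((S.P j i : ℝ) : ℂ) := by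
      funext i
      rw [← Complex.normSq_eq_conj_mul_self, Complex.normSq_mul, Complex.normSq_ofReal,
        Circle.normSq_coe, Real.mul_self_sqrt (S.nonneg j i), mul_one]
    rw [h, ← Complex.ofReal_one, Complex.hasSum_ofReal]
    exact S.hasSum_row j

/-- A block-diagonal density matrix `∑ ρ_i ⊗ |i⟩⟨i|` with `ρ_i ≥ 0` in `B(ℂ) = ℂ` and
`∑ Tr ρ_i = 1`, i.e. a probability measure on `Λ`. -/
structure InitialState (Λ : Type*) where
  weight : Λ → ℝ
  nonneg : ∀ i, 0 ≤ weight i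
  hasSum_one : HasSum weight 1

/-- The blocks of `𝓜ⁿ(ρ)`, where `𝓜(ρ)_i = ∑_j B_j^i ρ_j (B_j^i)^*`. -/
def Walk.evolve {Λ : Type*} (W : Walk Λ) (ρ : InitialState Λ) : ℕ → Λ → ℂ
  | 0 => fun i => (ρ.weight i : ℂ)
  | n + 1 => fun i => ∑' j, W.B i j * W.evolve ρ n j * conj (W.B i j)

/-- The von Neumann algebra `𝓑` of the block-diagonal operators `∑ x_j ⊗ |j⟩⟨j|` on
`ℂ ⊗ ℓ²(Λ)`: bounded families of complex numbers. -/
abbrev Obs (Λ : Type*) : Type _ := lp (fun _ : Λ => ℂ) ∞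

/-- The functional `x ↦ Tr(ρ x)` on `𝓑`. -/
def InitialState.eval {Λ : Type*} (ρ : InitialState Λ) (x : Obs Λ) : ℂ :=
  ∑' i, (ρ.weight i : ℂ) * x i

theorem Walk.hasSum_norm_sq {Λ : Type*} (W : Walk Λ) (j : Λ) :
    HasSum (fun i => ‖W.B i j‖ ^ 2) 1 := by
  have h := W.hasSum_effects j
  simp only [← Complex.normSq_eq_conj_mul_self, Complex.normSq_eq_norm_sq] at h
  rwa [← Complex.ofReal_one, Complex.hasSum_ofReal] at h

theorem Walk.norm_term_le {Λ : Type*} (W : Walk Λ) (y : Obs Λ) (i j : Λ) :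
    ‖conj (W.B i j) * y i * W.B i j‖ ≤ ‖y‖ * ‖W.B i j‖ ^ 2 := by
  have hy : ‖y i‖ ≤ ‖y‖ := lp.norm_apply_le_norm ENNReal.top_ne_zero y i
  rw [norm_mul, norm_mul, RCLike.norm_conj]
  nlinarith [mul_le_mul_of_nonneg_right hy (sq_nonneg ‖W.B i j‖)]

theorem Walk.summable_term {Λ : Type*} (W : Walk Λ) (y : Obs Λ) (j : Λ) :
    Summable (fun i => conj (W.B i j) * y i * W.B i j) :=
  Summable.of_norm_bounded ((W.hasSum_norm_sq j).summable.mul_left ‖y‖)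
    (fun i => W.norm_term_le y i j)

/-- The `j`-th block of `∑_{j : r_j ≠ 0} ∑_i Tr(r_j x_j)/Tr(r_j) (M_j^i)^* y M_j^i`,
where `M_j^i = B_j^i ⊗ |i⟩⟨j|`. -/
def Walk.transitionFun {Λ : Type*} (W : Walk Λ) (r : Λ → ℂ) (x y : Obs Λ) (j : Λ) : ℂ := by
  classical
  exact if r j = 0 then 0 else (r j * x j) / r j * ∑' i, conj (W.B i j) * y i * W.B i j

theorem Walk.norm_transitionFun_le {Λ : Type*} (W : Walk Λ) (r : Λ → ℂ) (x y : Obs Λ) (j : Λ) :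
    ‖W.transitionFun r x y j‖ ≤ ‖x‖ * ‖y‖ := by
  unfold Walk.transitionFun
  split_ifs with h
  · simpa using mul_nonneg (norm_nonneg x) (norm_nonneg y)
  · rw [mul_div_cancel_left₀ _ h, norm_mul]
    have h2 : ‖∑' i, conj (W.B i j) * y i * W.B i j‖ ≤ ‖y‖ := by
      have := tsum_of_norm_bounded ((W.hasSum_norm_sq j).mul_left ‖y‖)
        (fun i => W.norm_term_le y i j)
      simpa using this
    exact mul_le_mul (lp.norm_apply_le_norm ENNReal.top_ne_zero x j) h2 (norm_nonneg _)
      (norm_nonneg _)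

/-- The transition expectation `𝓔(x ⊗ y)` of the walk for the blocks `r`, as a bilinear map. -/
def Walk.transition {Λ : Type*} (W : Walk Λ) (r : Λ → ℂ) : Obs Λ →ₗ[ℂ] Obs Λ →ₗ[ℂ] Obs Λ :=
  LinearMap.mk₂ ℂ
    (fun x y => ⟨W.transitionFun r x y, memℓp_infty
      ⟨‖x‖ * ‖y‖, by rintro _ ⟨j, rfl⟩; exact W.norm_transitionFun_le r x y j⟩⟩)
    (fun x x' y => by
      ext j
      change W.transitionFun r (x + x') y j = W.transitionFun r x y j + W.transitionFun r x' y j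
      simp only [Walk.transitionFun, lp.coeFn_add, Pi.add_apply]
      split_ifs <;> ring)
    (fun c x y => by
      ext j
      change W.transitionFun r (c • x) y j = c * W.transitionFun r x y j
      simp only [Walk.transitionFun, lp.coeFn_smul, Pi.smul_apply, smul_eq_mul]
      split_ifs <;> ring)
    (fun x y y' => by
      ext j
      change W.transitionFun r x (y + y') j = W.transitionFun r x y j + W.transitionFun r x y' j
      have h : ∑' i, conj (W.B i j) * (y + y') i * W.B i j =
          ∑' i, conj (W.B i j) * y i * W.B i j + ∑' i, conj (W.B i j) * y' i * W.B i j := by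
        rw [← (W.summable_term y j).tsum_add (W.summable_term y' j)]
        refine tsum_congr fun i => ?_
        simp only [lp.coeFn_add, Pi.add_apply]
        ring
      simp only [Walk.transitionFun, h]
      split_ifs <;> ring)
    (fun c x y => by
      ext j
      change W.transitionFun r x (c • y) j = c * W.transitionFun r x y j
      have h : ∑' i, conj (W.B i j) * (c • y) i * W.B i j =
          c * ∑' i, conj (W.B i j) * y i * W.B i j := by
        rw [← tsum_mul_left]
        refine tsum_congr fun i => ?_
        simp only [lp.coeFn_smul, Pi.smul_apply, smul_eq_mul]
        ring
      simp only [Walk.transitionFun, h]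
      split_ifs <;> ring)

/-- The transition expectations `𝓔⁽ⁿ⁾` of the walk with initial state `ρ`: those for the blocks
of `ρ⁽ⁿ⁾ = 𝓜ⁿ(ρ)`. -/
def Walk.expectations {Λ : Type*} (W : Walk Λ) (ρ : InitialState Λ) :
    ℕ → Obs Λ →ₗ[ℂ] Obs Λ →ₗ[ℂ] Obs Λ :=
  fun n => W.transition (W.evolve ρ n)

/-- For the walk of a classical chain, `𝓔⁽ⁿ⁾(x ⊗ y) = P_{ρ⁽ⁿ⁾} x P y`. -/
theorem StochasticMatrix.expectations_apply {Λ : Type*} (S : StochasticMatrix Λ)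
    (U : Λ → Λ → Circle) (ρ : InitialState Λ) (n : ℕ) (x y : Obs Λ) (j : Λ) :
    (S.toWalk U).expectations ρ n x y j =
      {i | (S.toWalk U).evolve ρ n i ≠ 0}.indicator (fun i => x i * ∑' k, (S.P i k : ℂ) * y k) j := by
  classical
  change (S.toWalk U).transitionFun _ x y j = _
  have h : ∀ i, conj ((S.toWalk U).B i j) * y i * (S.toWalk U).B i j = (S.P j i : ℂ) * y i := by
    intro i
    have h1 : conj ((S.toWalk U).B i j) * (S.toWalk U).B i j = (S.P j i : ℂ) := by
      change conj ((Real.sqrt (S.P j i) : ℂ) * (U i j : ℂ)) *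
        ((Real.sqrt (S.P j i) : ℂ) * (U i j : ℂ)) = _
      rw [← Complex.normSq_eq_conj_mul_self, Complex.normSq_mul, Complex.normSq_ofReal,
        Circle.normSq_coe, Real.mul_self_sqrt (S.nonneg j i), mul_one]
    rw [← h1]; ring
  simp only [Walk.transitionFun, h, Set.indicator_apply, Set.mem_ofPred_eq, ite_not, ne_eq]
  split_ifs with h0
  · rfl
  · rw [mul_div_cancel_left₀ _ h0]

/-! ### Quantum Markov chains over `𝓑` -/

/-- The product σ-algebra of the path space `Λ^ℕ`, with `Λ` discrete. -/
abbrev pathMeasurableSpace (Λ : Type*) : MeasurableSpace (ℕ → Λ) :=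
  @MeasurableSpace.pi ℕ (fun _ => Λ) (fun _ => ⊤)

/-- The algebra `𝓐 = ⨂_{n} 𝓑`. As `𝓑` is the algebra of bounded functions on `Λ`, the finite
tensor products are the algebras of bounded functions on `Λ^{n+1}`, and `𝓐` is the algebra of
bounded measurable functions on the path space `Λ^ℕ` (the closure of the finite tensor products
under limits of bounded pointwise convergent sequences). -/
def PathAlgebra (Λ : Type*) : StarSubalgebra ℂ ((ℕ → Λ) → ℂ) where
  carrier := {f | Measurable[pathMeasurableSpace Λ] f ∧ ∃ C : ℝ, ∀ ω, ‖f ω‖ ≤ C}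
  mul_mem' := by
    rintro f g ⟨hf, C, hC⟩ ⟨hg, D, hD⟩
    refine ⟨?_, C * D, fun ω => ?_⟩
    · let _ := pathMeasurableSpace Λ
      exact hf.mul hg
    · rw [Pi.mul_apply, norm_mul]
      exact mul_le_mul (hC ω) (hD ω) (norm_nonneg _) ((norm_nonneg _).trans (hC ω))
  add_mem' := by
    rintro f g ⟨hf, C, hC⟩ ⟨hg, D, hD⟩
    refine ⟨?_, C + D, fun ω => (norm_add_le _ _).trans (add_le_add (hC ω) (hD ω))⟩
    let _ := pathMeasurableSpace Λ
    exact hf.add hg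
  algebraMap_mem' := fun c =>
    ⟨@measurable_const _ _ _ (pathMeasurableSpace Λ) c, ‖c‖, fun _ => le_rfl⟩
  star_mem' := by
    rintro f ⟨hf, C, hC⟩
    refine ⟨?_, C, fun ω => ?_⟩
    · let _ := pathMeasurableSpace Λ
      exact Complex.continuous_conj.measurable.comp hf
    · rw [Pi.star_apply, norm_star]
      exact hC ω

theorem measurable_coord {Λ : Type*} (x : Λ → ℂ) (k : ℕ) :
    Measurable[pathMeasurableSpace Λ] (fun ω : ℕ → Λ => x (ω k)) := by
  let _ : MeasurableSpace Λ := ⊤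
  exact (measurable_from_top (f := x)).comp (measurable_pi_apply k)

/-- The embedding `J_k : 𝓑 → 𝓐` at the `k`-th tensor factor. -/
def embed {Λ : Type*} (k : ℕ) (x : Obs Λ) : PathAlgebra Λ :=
  ⟨fun ω => x (ω k), ⟨measurable_coord x k, ‖x‖,
    fun ω => lp.norm_apply_le_norm ENNReal.top_ne_zero x (ω k)⟩⟩

/-- `a_0 ⊗ a_1 ⊗ ⋯ ⊗ a_n ⊗ I ⊗ I ⊗ ⋯ = J_0(a_0) J_1(a_1) ⋯ J_n(a_n)`. -/
def localTensor {Λ : Type*} (a : ℕ → Obs Λ) (n : ℕ) : PathAlgebra Λ :=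
  ∏ k ∈ Finset.range (n + 1), embed k (a k)

/-- `p_{[n} = I ⊗ ⋯ ⊗ I ⊗ p ⊗ p ⊗ ⋯`, with `p` at all the places `k ≥ n`, for a projection
`p ∈ 𝓑` (whose values are `0` and `1`): the function `ω ↦ ∏_{k ≥ n} p(ω_k)`. -/
def tailProjection {Λ : Type*} [Countable Λ] (p : Obs Λ) (n : ℕ) : PathAlgebra Λ :=
  ⟨Set.indicator {ω : ℕ → Λ | ∀ k, n ≤ k → p (ω k) = 1} 1, ⟨by
    let _ := pathMeasurableSpace Λ
    refine measurable_one.indicator ?_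
    have h : {ω : ℕ → Λ | ∀ k, n ≤ k → p (ω k) = 1} =
        ⋂ k, ⋂ (_ : n ≤ k), (fun ω : ℕ → Λ => p (ω k)) ⁻¹' {1} := by
      ext ω; simp
    rw [h]
    exact MeasurableSet.iInter fun k => MeasurableSet.iInter fun _ =>
      measurable_coord p k (measurableSet_singleton 1), 1, fun ω => by
    by_cases h : ω ∈ {ω : ℕ → Λ | ∀ k, n ≤ k → p (ω k) = 1} <;> simp [h]⟩⟩

theorem coe_prod_path {Λ : Type*} {ι : Type*} (s : Finset ι) (f : ι → PathAlgebra Λ) :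
    ((∏ k ∈ s, f k : PathAlgebra Λ) : (ℕ → Λ) → ℂ) = ∏ k ∈ s, (f k : (ℕ → Λ) → ℂ) :=
  map_prod (PathAlgebra Λ).subtype f s

/-- For a projection `p`, the finite tensor products `p_{[n,N]}` converge to `p_{[n}`. -/
theorem tendsto_tailProjection {Λ : Type*} [Countable Λ] (p : Obs Λ) (hp : IsStarProjection p)
    (n : ℕ) (ω : ℕ → Λ) :
    Filter.Tendsto (fun N => ((∏ k ∈ Finset.Ico n (N + 1), embed k p : PathAlgebra Λ) :
        (ℕ → Λ) → ℂ) ω) Filter.atTop (𝓝 ((tailProjection p n : (ℕ → Λ) → ℂ) ω)) := by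
  have hval : ∀ N, ((∏ k ∈ Finset.Ico n (N + 1), embed k p : PathAlgebra Λ) :
      (ℕ → Λ) → ℂ) ω = ∏ k ∈ Finset.Ico n (N + 1), p (ω k) := by
    intro N
    rw [coe_prod_path, Finset.prod_apply]
    rfl
  have h01 : ∀ i, p i ≠ 1 → p i = 0 := by
    intro i hi
    have h : p i * p i = p i := by
      have := congrArg (fun q : Obs Λ => q i) hp.isIdempotentElem.eq
      simpa [lp.infty_coeFn_mul] using this
    have : p i * (p i - 1) = 0 := by rw [mul_sub, h]; ring
    exact (mul_eq_zero.mp this).resolve_right (sub_ne_zero.mpr hi)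
  simp only [hval]
  change Filter.Tendsto _ _
    (𝓝 (Set.indicator {ω : ℕ → Λ | ∀ k, n ≤ k → p (ω k) = 1} (1 : (ℕ → Λ) → ℂ) ω))
  by_cases h : ∀ k, n ≤ k → p (ω k) = 1
  · rw [Set.indicator_of_mem (by exact h)]
    refine tendsto_const_nhds.congr fun N => ?_
    rw [Finset.prod_eq_one fun k hk => h k (Finset.mem_Ico.mp hk).1]
    rfl
  · rw [Set.indicator_of_notMem (by exact h)]
    push Not at h
    obtain ⟨k, hk, hne⟩ := h
    refine tendsto_const_nhds.congr' ?_
    filter_upwards [Filter.eventually_ge_atTop k] with N hN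
    exact (Finset.prod_eq_zero (Finset.mem_Ico.mpr ⟨hk, by omega⟩) (h01 _ hne)).symm

/-- `𝓔⁽ᵐ⁾(a_m ⊗ 𝓔⁽ᵐ⁺¹⁾(a_{m+1} ⊗ ⋯ ⊗ 𝓔⁽ᵐ⁺ᵏ⁻¹⁾(a_{m+k-1} ⊗ c)))`, with `k` nested
transition expectations. -/
def nested {Λ : Type*} (E : ℕ → Obs Λ →ₗ[ℂ] Obs Λ →ₗ[ℂ] Obs Λ) (a : ℕ → Obs Λ) (c : Obs Λ) :
    ℕ → ℕ → Obs Λ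
  | _, 0 => c
  | m, k + 1 => E m (a m) (nested E a c (m + 1) k)

/-- `b` is the (strong, i.e. pointwise) limit
`lim_k 𝓔⁽ⁿ⁾(I ⊗ 𝓔⁽ⁿ⁺¹⁾(I ⊗ ⋯ ⊗ 𝓔⁽ⁿ⁺ᵏ⁾(I ⊗ I)))`. -/
def IsLimitElement {Λ : Type*} (E : ℕ → Obs Λ →ₗ[ℂ] Obs Λ →ₗ[ℂ] Obs Λ) (n : ℕ) (b : Obs Λ) :
    Prop :=
  ∀ j, Filter.Tendsto (fun k : ℕ => nested E (fun _ => 1) 1 n (k + 1) j) Filter.atTop (𝓝 (b j))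

/-- `F` is the map `E_{0]} : 𝓐 → 𝓐_{0]} = 𝓑` of the transition expectations `E`: the (completely)
positive, sub-Markovian linear map given by the nested transition expectations, closed off with the
limit elements, on finite tensors, and extended by limits. Both algebras being commutative,
positivity is complete positivity. It is unique: see `IsForwardMap.unique`. -/
structure IsForwardMap {Λ : Type*} (E : ℕ → Obs Λ →ₗ[ℂ] Obs Λ →ₗ[ℂ] Obs Λ)
    (F : PathAlgebra Λ →ₗ[ℂ] Obs Λ) : Prop where
  nonneg : ∀ f : PathAlgebra Λ, (∀ ω, 0 ≤ (f : (ℕ → Λ) → ℂ) ω) → ∀ j, 0 ≤ F f j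
  subMarkov : ∀ j, F 1 j ≤ 1
  local_eq : ∃ b : ℕ → Obs Λ, (∀ n, IsLimitElement E n (b n)) ∧
    ∀ (a : ℕ → Obs Λ) (n : ℕ), F (localTensor a n) = nested E a (b (n + 1)) 0 (n + 1)
  limit : ∀ (f : ℕ → PathAlgebra Λ) (g : PathAlgebra Λ),
    (∃ C : ℝ, ∀ k ω, ‖(f k : (ℕ → Λ) → ℂ) ω‖ ≤ C) →
    (∀ ω, Filter.Tendsto (fun k => (f k : (ℕ → Λ) → ℂ) ω) Filter.atTop
      (𝓝 ((g : (ℕ → Λ) → ℂ) ω))) →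
    ∀ j, Filter.Tendsto (fun k => F (f k) j) Filter.atTop (𝓝 (F g j))

/-- The indicator function of a measurable set of paths, as an element of `𝓐`. -/
def pathIndicator {Λ : Type*} (s : Set (ℕ → Λ))
    (hs : MeasurableSet[pathMeasurableSpace Λ] s) : PathAlgebra Λ :=
  ⟨s.indicator 1, ⟨by
    let _ := pathMeasurableSpace Λ
    exact measurable_one.indicator hs, 1, fun ω => by by_cases h : ω ∈ s <;> simp [h]⟩⟩

/-- The map `E_{0]}` is unique. -/
theorem IsForwardMap.unique {Λ : Type*} {E : ℕ → Obs Λ →ₗ[ℂ] Obs Λ →ₗ[ℂ] Obs Λ}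
    {F G : PathAlgebra Λ →ₗ[ℂ] Obs Λ} (hF : IsForwardMap E F) (hG : IsForwardMap E G) :
    F = G := by
  classical
  let _ : MeasurableSpace Λ := ⊤
  -- agreement on finite tensors
  have hloc : ∀ a n, F (localTensor a n) = G (localTensor a n) := by
    obtain ⟨b, hb, hFb⟩ := hF.local_eq
    obtain ⟨c, hc, hGc⟩ := hG.local_eq
    have hbc : b = c := by
      funext n
      ext j
      exact tendsto_nhds_unique (hb n j) (hc n j)
    intro a n
    rw [hFb, hGc, hbc]
  have hone : F 1 = G 1 := by
    have h : localTensor (fun _ => (1 : Obs Λ)) 0 = 1 := by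
      apply Subtype.ext
      funext ω
      simp [localTensor, embed]
    rw [← h, hloc]
  -- agreement on indicator functions
  let Cyl : Set (Set (ℕ → Λ)) := {s | ∃ (n : ℕ) (t : ℕ → Set Λ), s = {ω | ∀ k ≤ n, ω k ∈ t k}}
  have hgen : pathMeasurableSpace Λ = MeasurableSpace.generateFrom Cyl := by
    apply le_antisymm
    · refine iSup_le fun k => ?_
      rintro _ ⟨T, -, rfl⟩
      refine MeasurableSpace.measurableSet_generateFrom
        ⟨k, fun l => if l = k then T else Set.univ, ?_⟩
      ext ω
      constructor
      · intro h l _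
        by_cases hl : l = k
        · subst hl; simpa using h
        · simp [hl]
      · intro h
        simpa using h k le_rfl
    · refine MeasurableSpace.generateFrom_le ?_
      rintro _ ⟨n, t, rfl⟩
      have : {ω : ℕ → Λ | ∀ k ≤ n, ω k ∈ t k} =
          ⋂ k, ⋂ (_ : k ≤ n), (fun ω : ℕ → Λ => ω k) ⁻¹' t k := by
        ext ω; simp
      rw [this]
      exact MeasurableSet.iInter fun k => MeasurableSet.iInter fun _ =>
        measurable_pi_apply k (MeasurableSpace.measurableSet_top)
  have hpi : IsPiSystem Cyl := by
    rintro _ ⟨n, t, rfl⟩ _ ⟨m, u, rfl⟩ -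
    refine ⟨max n m, fun k => (if k ≤ n then t k else Set.univ) ∩
      (if k ≤ m then u k else Set.univ), ?_⟩
    ext ω
    constructor
    · rintro ⟨h1, h2⟩ k _
      refine ⟨?_, ?_⟩
      · by_cases hk : k ≤ n
        · simpa [hk] using h1 k hk
        · simp [hk]
      · by_cases hk : k ≤ m
        · simpa [hk] using h2 k hk
        · simp [hk]
    · intro h
      refine ⟨fun k hk => ?_, fun k hk => ?_⟩
      · simpa [hk] using (h k (le_max_of_le_left hk)).1
      · simpa [hk] using (h k (le_max_of_le_right hk)).2
  have hind : ∀ s (hs : MeasurableSet[pathMeasurableSpace Λ] s),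
      F (pathIndicator s hs) = G (pathIndicator s hs) := by
    refine MeasurableSpace.induction_on_inter hgen hpi ?_ ?_ ?_ ?_
    · have : pathIndicator (∅ : Set (ℕ → Λ)) (@MeasurableSet.empty _ (pathMeasurableSpace Λ)) = 0 := by
        apply Subtype.ext
        funext ω
        simp [pathIndicator]
      rw [this, map_zero, map_zero]
    · rintro _ ⟨n, t, rfl⟩
      have hmem : ∀ k, Memℓp (fun i => (t k).indicator (1 : Λ → ℂ) i) ∞ := fun k =>
        memℓp_infty ⟨1, by
          rintro _ ⟨i, rfl⟩
          by_cases h : i ∈ t k <;> simp [h]⟩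
      have : ∀ hs, pathIndicator {ω : ℕ → Λ | ∀ k ≤ n, ω k ∈ t k} hs =
          localTensor (fun k => (⟨_, hmem k⟩ : Obs Λ)) n := by
        intro hs
        apply Subtype.ext
        rw [localTensor, coe_prod_path]
        funext ω
        rw [Finset.prod_apply]
        change Set.indicator {ω : ℕ → Λ | ∀ k ≤ n, ω k ∈ t k} 1 ω =
          ∏ k ∈ Finset.range (n + 1), (t k).indicator (1 : Λ → ℂ) (ω k)
        by_cases h : ∀ k ≤ n, ω k ∈ t k
        · rw [Set.indicator_of_mem (by exact h), Finset.prod_eq_one]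
          · rfl
          · intro k hk
            rw [Set.indicator_of_mem (h k (Nat.lt_succ_iff.mp (Finset.mem_range.mp hk)))]
            rfl
        · rw [Set.indicator_of_notMem (by exact h)]
          push Not at h
          obtain ⟨k, hk, hne⟩ := h
          rw [Finset.prod_eq_zero (Finset.mem_range.mpr (Nat.lt_succ_of_le hk))
            (Set.indicator_of_notMem hne _)]
      rw [this, hloc]
    · intro s hs ih
      have : pathIndicator sᶜ hs.compl =
          1 - pathIndicator s hs := by
        apply Subtype.ext
        funext ω
        change sᶜ.indicator 1 ω = 1 - s.indicator (1 : (ℕ → Λ) → ℂ) ω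
        by_cases h : ω ∈ s <;> simp [h]
      rw [this, map_sub, map_sub, ih, hone]
    · intro f hd hm ih
      have hcoe : ∀ N ω, ((∑ k ∈ Finset.range N, pathIndicator (f k) (hm k) : PathAlgebra Λ) :
          (ℕ → Λ) → ℂ) ω = (⋃ k ∈ Finset.range N, f k).indicator 1 ω := by
        intro N ω
        have h1 : ((∑ k ∈ Finset.range N, pathIndicator (f k) (hm k) : PathAlgebra Λ) :
            (ℕ → Λ) → ℂ) = ∑ k ∈ Finset.range N, (pathIndicator (f k) (hm k) : (ℕ → Λ) → ℂ) :=
          map_sum (PathAlgebra Λ).subtype _ _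
        rw [h1, Finset.sum_apply, Finset.indicator_biUnion_apply]
        · rfl
        · exact fun i _ j _ hij => hd hij
      have hb : ∃ C : ℝ, ∀ N ω, ‖((∑ k ∈ Finset.range N, pathIndicator (f k) (hm k) :
          PathAlgebra Λ) : (ℕ → Λ) → ℂ) ω‖ ≤ C := by
        refine ⟨1, fun N ω => ?_⟩
        rw [hcoe]
        by_cases h : ω ∈ ⋃ k ∈ Finset.range N, f k
        · rw [Set.indicator_of_mem h]; simp
        · rw [Set.indicator_of_notMem h]; simp
      have hl : ∀ ω, Filter.Tendsto (fun N => ((∑ k ∈ Finset.range N,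
          pathIndicator (f k) (hm k) : PathAlgebra Λ) : (ℕ → Λ) → ℂ) ω) Filter.atTop
          (𝓝 ((pathIndicator (⋃ k, f k) (@MeasurableSet.iUnion _ _ (pathMeasurableSpace Λ) _ _ hm) :
            (ℕ → Λ) → ℂ) ω)) := by
        intro ω
        simp only [hcoe]
        change Filter.Tendsto _ _ (𝓝 ((⋃ k, f k).indicator 1 ω))
        by_cases h : ω ∈ ⋃ k, f k
        · obtain ⟨k, hk⟩ := Set.mem_iUnion.mp h
          refine tendsto_const_nhds.congr' ?_
          filter_upwards [Filter.eventually_gt_atTop k] with N hN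
          rw [Set.indicator_of_mem h, Set.indicator_of_mem]
          exact Set.mem_biUnion (Finset.mem_coe.mpr (Finset.mem_range.mpr hN)) hk
        · refine tendsto_const_nhds.congr fun N => ?_
          rw [Set.indicator_of_notMem h, Set.indicator_of_notMem]
          intro h'
          obtain ⟨k, -, hk⟩ := Set.mem_iUnion₂.mp h'
          exact h (Set.mem_iUnion.mpr ⟨k, hk⟩)
      ext j
      refine tendsto_nhds_unique (hF.limit _ _ hb hl j) ?_
      have := hG.limit _ _ hb hl j
      simpa only [map_sum, ih] using this
  -- agreement on simple functions
  have hsimple : ∀ (g : @MeasureTheory.SimpleFunc (ℕ → Λ) (pathMeasurableSpace Λ) ℂ)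
      (hg : (g : (ℕ → Λ) → ℂ) ∈ PathAlgebra Λ), F ⟨g, hg⟩ = G ⟨g, hg⟩ := by
    let _ := pathMeasurableSpace Λ
    intro g
    induction g using MeasureTheory.SimpleFunc.induction with
    | const c hs =>
      intro hg
      have : (⟨_, hg⟩ : PathAlgebra Λ) = c • pathIndicator _ hs := by
        apply Subtype.ext
        funext ω
        change (MeasureTheory.SimpleFunc.piecewise _ hs _ _) ω = c * Set.indicator _ 1 ω
        rw [MeasureTheory.SimpleFunc.piecewise_apply, Set.indicator_apply]
        split_ifs <;> simp
      rw [this, map_smul, map_smul, hind]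
    | add hd hu hv =>
      rename_i u v
      intro hg
      have mem : ∀ w : MeasureTheory.SimpleFunc (ℕ → Λ) ℂ, (w : (ℕ → Λ) → ℂ) ∈ PathAlgebra Λ := by
        intro w
        obtain ⟨C, hC⟩ := w.exists_forall_norm_le
        exact ⟨w.measurable, C, hC⟩
      have : (⟨_, hg⟩ : PathAlgebra Λ) = ⟨u, mem u⟩ + ⟨v, mem v⟩ := rfl
      rw [this, map_add, map_add, hu, hv]
  -- agreement everywhere
  ext f j
  obtain ⟨g, hg⟩ := f
  obtain ⟨hm, C, hC⟩ := id hg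
  let _ := pathMeasurableSpace Λ
  have hsm : MeasureTheory.StronglyMeasurable g := Measurable.stronglyMeasurable hm
  have mem : ∀ w : MeasureTheory.SimpleFunc (ℕ → Λ) ℂ, (w : (ℕ → Λ) → ℂ) ∈ PathAlgebra Λ := by
    intro w
    obtain ⟨C, hC⟩ := w.exists_forall_norm_le
    exact ⟨w.measurable, C, hC⟩
  have hb : ∃ D : ℝ, ∀ (k : ℕ) ω, ‖((⟨hsm.approxBounded C k, mem _⟩ : PathAlgebra Λ) :
      (ℕ → Λ) → ℂ) ω‖ ≤ D := by
    refine ⟨|C|, fun k ω => ?_⟩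
    by_cases h0 : 0 ≤ C
    · exact (hsm.norm_approxBounded_le h0 k ω).trans (le_abs_self C)
    · exact absurd ((norm_nonneg _).trans (hC ω)) h0
  have hl : ∀ ω, Filter.Tendsto (fun k : ℕ => ((⟨hsm.approxBounded C k, mem _⟩ : PathAlgebra Λ) :
      (ℕ → Λ) → ℂ) ω) Filter.atTop (𝓝 (((⟨g, hg⟩ : PathAlgebra Λ) : (ℕ → Λ) → ℂ) ω)) :=
    fun ω => hsm.tendsto_approxBounded_of_norm_le (hC ω)
  refine tendsto_nhds_unique (hF.limit _ _ hb hl j) ?_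
  have := hG.limit _ _ hb hl j
  simpa only [hsimple] using this

/-- `(φ₀, (𝓔⁽ⁿ⁾))` is a Markov pair, `F` being its map `E_{0]}`: the functional
`φ(a) = φ₀(E_{0]}(a))` satisfies `φ(I ⊗ I ⊗ ⋯) = 1`. -/
def IsMarkovPair {Λ : Type*} (ρ : InitialState Λ) (E : ℕ → Obs Λ →ₗ[ℂ] Obs Λ →ₗ[ℂ] Obs Λ)
    (F : PathAlgebra Λ →ₗ[ℂ] Obs Λ) : Prop :=
  IsForwardMap E F ∧ ρ.eval (F 1) = 1

/-- The pair `(ρ, (𝓔⁽ⁿ⁾))` is a quantum Markov chain and this chain is reducible: there are a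
projection `p ∈ 𝓑`, `p ≠ 0, I`, and `n₀` such that
`E_{0]}(p_{[n₀} a p_{[n₀}) = E_{0]}(a)` for all `a ∈ 𝓐`. -/
def IsReducibleQMC {Λ : Type*} [Countable Λ] (ρ : InitialState Λ)
    (E : ℕ → Obs Λ →ₗ[ℂ] Obs Λ →ₗ[ℂ] Obs Λ) : Prop :=
  ∃ F : PathAlgebra Λ →ₗ[ℂ] Obs Λ, IsMarkovPair ρ E F ∧
    ∃ (p : Obs Λ) (n₀ : ℕ), IsStarProjection p ∧ p ≠ 0 ∧ p ≠ 1 ∧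
      ∀ a : PathAlgebra Λ, F (tailProjection p n₀ * a * tailProjection p n₀) = F a

end OQRW

end

noncomputable section

namespace OQRW

open MeasureTheory ProbabilityTheory

namespace StochasticMatrix

/-! ### Accessibility -/

/-! The phases cancel in `|B i j|² = P(j,i)`, so the evolved blocks form the classical law of the
chain at time `n`, and each transition expectation is `P` cut off by the support of that law. A step
of positive probability from the support at time `n` lands in the support at time `n + 1`
(`law_succ_ne_zero`). A chain started in the support of `ρ` therefore almost surely never meets a
cut-off: `b̄(n)` is the indicator of the support, and `E_{0]}` sends `f` to `j ↦ 𝔼_j[f]`, set to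
zero off the support of `ρ`.

The expectation `𝔼_j` is taken under a path measure obtained from the Ionescu-Tulcea construction.
The Markov property `integral_pathMeasure_succ`, iterated in `integral_nested`, identifies it with
the nested expectations on finite tensors. Dominated convergence gives the limit axiom, and the mass
is one because `ρ` lives on its own support.

If `ρ` is supported on a forward-closed `C`, almost every path stays in `C`, so the tail projection
of the indicator of `C` equals one almost surely; `n₀ = 0` suffices. When the chain is reducible,
such a `C` is the set of states accessible from a state that does not reach every other. -/

theorem entry_le_one {Λ : Type*} (S : StochasticMatrix Λ) (i j : Λ) : S.P i j ≤ 1 :=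
  le_hasSum (S.hasSum_row i) j fun k _ => S.nonneg i k

theorem summable_mul_of_le_one {Λ : Type*} (S : StochasticMatrix Λ) (i : Λ) {f : Λ → ℝ}
    (h0 : ∀ k, 0 ≤ f k) (h1 : ∀ k, f k ≤ 1) : Summable fun k => S.P i k * f k :=
  Summable.of_nonneg_of_le (fun k => mul_nonneg (S.nonneg i k) (h0 k))
    (fun k => mul_le_of_le_one_right (S.nonneg i k) (h1 k)) (S.hasSum_row i).summable

theorem pow_nonneg_and_le_one {Λ : Type*} (S : StochasticMatrix Λ) (n : ℕ) :
    ∀ i j, 0 ≤ S.pow n i j ∧ S.pow n i j ≤ 1 := by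
  induction n with
  | zero =>
    intro i j
    by_cases h : j ∈ ({i} : Set Λ) <;> simp [pow, h]
  | succ n ih =>
    intro i j
    refine ⟨tsum_nonneg fun k => mul_nonneg (S.nonneg i k) (ih k j).1, ?_⟩
    rw [← (S.hasSum_row i).tsum_eq]
    exact (S.summable_mul_of_le_one i (fun k => (ih k j).1) fun k => (ih k j).2).tsum_le_tsum
      (fun k => mul_le_of_le_one_right (S.nonneg i k) (ih k j).2) (S.hasSum_row i).summable

/-- A series of nonnegative terms is positive exactly when one term is. Summability matters for the
converse, since a divergent `tsum` would be zero. -/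
theorem pow_succ_pos_iff {Λ : Type*} (S : StochasticMatrix Λ) (n : ℕ) (i j : Λ) :
    0 < S.pow (n + 1) i j ↔ ∃ k, 0 < S.P i k ∧ 0 < S.pow n k j := by
  have hn : ∀ k, 0 ≤ S.P i k * S.pow n k j := fun k =>
    mul_nonneg (S.nonneg i k) (S.pow_nonneg_and_le_one n k j).1
  constructor
  · intro h
    by_contra! hc
    refine h.ne' ((tsum_congr fun k => ?_).trans tsum_zero)
    rcases (S.nonneg i k).eq_or_lt with h0 | h0
    · rw [← h0, zero_mul]
    · rw [le_antisymm (hc k h0) (S.pow_nonneg_and_le_one n k j).1, mul_zero]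
  · rintro ⟨k, h1, h2⟩
    exact (S.summable_mul_of_le_one i (fun k => (S.pow_nonneg_and_le_one n k j).1)
      fun k => (S.pow_nonneg_and_le_one n k j).2).tsum_pos hn k (mul_pos h1 h2)

theorem Accessible.refl {Λ : Type*} (S : StochasticMatrix Λ) (i : Λ) : S.Accessible i i :=
  ⟨0, by simp [pow]⟩

theorem Accessible.head {Λ : Type*} {S : StochasticMatrix Λ} {i j k : Λ} (h : 0 < S.P i j) :
    S.Accessible j k → S.Accessible i k :=
  fun ⟨n, hn⟩ => ⟨n + 1, (S.pow_succ_pos_iff n i k).2 ⟨j, h, hn⟩⟩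

theorem Accessible.of_pos {Λ : Type*} {S : StochasticMatrix Λ} {i j : Λ} (h : 0 < S.P i j) :
    S.Accessible i j :=
  .head h (.refl S j)

theorem Accessible.trans {Λ : Type*} {S : StochasticMatrix Λ} {i j k : Λ}
    (hij : S.Accessible i j) (hjk : S.Accessible j k) : S.Accessible i k := by
  obtain ⟨n, hn⟩ := hij
  induction n generalizing i with
  | zero =>
    have : j = i := by
      by_contra h
      simp [pow, h] at hn
    rwa [← this]
  | succ n ih =>
    obtain ⟨l, h1, h2⟩ := (S.pow_succ_pos_iff n i j).1 hn
    exact .head h1 (ih h2)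

theorem forwardClosed_accessible {Λ : Type*} (S : StochasticMatrix Λ) (i : Λ) :
    S.ForwardClosed {j | S.Accessible i j} :=
  fun _ hj _ => hj.trans

theorem Reducible.exists_forwardClosed {Λ : Type*} {S : StochasticMatrix Λ} (hS : S.Reducible) :
    ∃ C : Set Λ, C.Nonempty ∧ C ≠ Set.univ ∧ S.ForwardClosed C := by
  have : ∃ i j, ¬ S.Accessible i j := by
    by_contra! h
    exact hS fun i j => ⟨h i j, h j i⟩
  obtain ⟨i, j, h⟩ := this
  -- The witness is the set of states accessible from `i`; it contains `i` and misses `j`.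
  exact ⟨_, ⟨i, .refl S i⟩, fun hu => h (Set.eq_univ_iff_forall.1 hu j),
    S.forwardClosed_accessible i⟩

/-! ### The path measure of the classical chain -/

/-- The law of one step from the state `i`. -/
def stepPMF {Λ : Type*} (S : StochasticMatrix Λ) (i : Λ) : PMF Λ :=
  ⟨fun j => ENNReal.ofReal (S.P i j), by
    rw [← ENNReal.ofReal_one, ← (S.hasSum_row i).tsum_eq,
      ENNReal.ofReal_tsum_of_nonneg (S.nonneg i) (S.hasSum_row i).summable]
    exact ENNReal.summable.hasSum⟩

/-- Provides the uniform bound that makes product functions integrable in the Markov property. -/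
theorem norm_prod_obs_le {ι Λ : Type*} (s : Finset ι) (a : ι → Obs Λ) (z : ι → Λ) :
    ‖∏ i ∈ s, a i (z i)‖ ≤ ∏ i ∈ s, ‖a i‖ := by
  rw [norm_prod]
  exact Finset.prod_le_prod (fun _ _ => norm_nonneg _)
    fun i _ => lp.norm_apply_le_norm ENNReal.top_ne_zero (a i) (z i)

section PathMeasure

variable {Λ : Type*} [MeasurableSpace Λ] [DiscreteMeasurableSpace Λ]

theorem ae_stepPMF_pos (S : StochasticMatrix Λ) (i : Λ) :
    ∀ᵐ j ∂(S.stepPMF i).toMeasure, 0 < S.P i j := by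
  rw [ae_iff, PMF.toMeasure_apply_eq_zero_iff _ (.of_discrete), Set.disjoint_left]
  intro j hj hj'
  rw [PMF.mem_support_iff] at hj
  exact hj (ENNReal.ofReal_eq_zero.2 (not_lt.1 hj'))

/-- The transition kernel from the past up to time `n` to the state at time `n + 1`. -/
def stepKernel (S : StochasticMatrix Λ) (n : ℕ) : Kernel (Finset.Iic n → Λ) Λ where
  toFun z := (S.stepPMF (z ⟨n, Finset.mem_Iic.2 le_rfl⟩)).toMeasure
  -- The kernel depends on the past only through its last coordinate, and every function on the
  -- discrete `Λ` is measurable.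
  measurable' := (Measurable.of_discrete (f := fun i => (S.stepPMF i).toMeasure)).comp
    (measurable_pi_apply _)

instance (S : StochasticMatrix Λ) (n : ℕ) : IsMarkovKernel (S.stepKernel n) :=
  ⟨fun _ => inferInstanceAs (IsProbabilityMeasure (S.stepPMF _).toMeasure)⟩

/-- The law of the path of the chain started at `j`. -/
def pathMeasure (S : StochasticMatrix Λ) (j : Λ) : Measure (ℕ → Λ) :=
  Kernel.traj (X := fun _ => Λ) S.stepKernel 0 fun _ => j

instance (S : StochasticMatrix Λ) (j : Λ) : IsProbabilityMeasure (S.pathMeasure j) :=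
  inferInstanceAs (IsProbabilityMeasure (Kernel.traj (X := fun _ => Λ) S.stepKernel 0 _))

/-- The marginal of the trajectory measure on the coordinates up to time `0` is the Dirac mass at
the starting point. -/
theorem ae_pathMeasure_zero (S : StochasticMatrix Λ) (j : Λ) :
    ∀ᵐ ω ∂S.pathMeasure j, ω 0 = j := by
  have h := Kernel.traj_map_frestrictLe_apply (X := fun _ => Λ) (κ := S.stepKernel) 0 0 fun _ => j
  rw [Kernel.partialTraj_self, Kernel.id_apply] at h
  have h2 : ∀ᵐ z ∂Measure.dirac (fun _ : Finset.Iic 0 => j),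
      z ⟨0, Finset.mem_Iic.2 le_rfl⟩ = j := by
    rw [ae_dirac_iff]
    exact measurableSet_preimage (f := fun z : Finset.Iic 0 → Λ => z ⟨0, Finset.mem_Iic.2 le_rfl⟩)
      (measurable_pi_apply _) (MeasurableSet.of_discrete (s := {j}))
  rw [← h] at h2
  exact ae_of_ae_map (Preorder.measurable_frestrictLe 0).aemeasurable h2

variable [Countable Λ]

theorem integral_stepPMF (S : StochasticMatrix Λ) (i : Λ) (y : Obs Λ) :
    ∫ k, y k ∂(S.stepPMF i).toMeasure = ∑' k, (S.P i k : ℂ) * y k := by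
  rw [PMF.integral_eq_tsum]
  · refine tsum_congr fun k => ?_
    change (ENNReal.ofReal (S.P i k)).toReal • y k = _
    rw [ENNReal.toReal_ofReal (S.nonneg i k), Complex.real_smul]
  · exact .of_bound (Measurable.of_discrete (f := y)).aestronglyMeasurable ‖y‖
      (.of_forall fun k => lp.norm_apply_le_norm ENNReal.top_ne_zero y k)

/-- The joint law of the past up to `m` and the state at `m + 1` is the composition of the past's
law with `stepKernel`, and each one-step law charges only successors of positive probability.
Countably many times cost only a null set. -/
theorem ae_pathMeasure_pos (S : StochasticMatrix Λ) (j : Λ) :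
    ∀ᵐ ω ∂S.pathMeasure j, ∀ m, 0 < S.P (ω m) (ω (m + 1)) := by
  rw [ae_all_iff]
  intro m
  have h := Kernel.partialTraj_compProd_eq_map_traj (X := fun _ => Λ) (κ := S.stepKernel)
    (zero_le : 0 ≤ m) (x₀ := fun _ => j)
  have h2 : ∀ᵐ q ∂(Kernel.partialTraj (X := fun _ => Λ) S.stepKernel 0 m fun _ => j) ⊗ₘ
      S.stepKernel m, 0 < S.P (q.1 ⟨m, Finset.mem_Iic.2 le_rfl⟩) q.2 :=
    Measure.ae_compProd_of_ae_ae
      (measurableSet_preimage (f := fun q : (Finset.Iic m → Λ) × Λ =>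
          (q.1 ⟨m, Finset.mem_Iic.2 le_rfl⟩, q.2))
        (((measurable_pi_apply _).comp measurable_fst).prodMk measurable_snd)
        (MeasurableSet.of_discrete (s := {q : Λ × Λ | 0 < S.P q.1 q.2})))
      (.of_forall fun z => S.ae_stepPMF_pos _)
  rw [h] at h2
  exact ae_of_ae_map
    (f := fun ω : ℕ → Λ => (Preorder.frestrictLe (π := fun _ => Λ) m ω, ω (m + 1)))
    (by fun_prop) h2

/-- The sets may depend on time so that one lemma serves both the moving supports of the laws and a
fixed forward-closed set. -/
theorem ae_pathMeasure_mem (S : StochasticMatrix Λ) {A : ℕ → Set Λ}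
    (hA : ∀ m, ∀ i ∈ A m, ∀ k, 0 < S.P i k → k ∈ A (m + 1)) {j : Λ} (hj : j ∈ A 0) :
    ∀ᵐ ω ∂S.pathMeasure j, ∀ m, ω m ∈ A m := by
  filter_upwards [S.ae_pathMeasure_zero j, S.ae_pathMeasure_pos j] with ω h0 hp m
  induction m with
  | zero => rwa [h0]
  | succ m ih => exact hA m _ ih _ (hp m)

/-- The Markov property, tested on product functions of the past. -/
theorem integral_pathMeasure_succ (S : StochasticMatrix Λ) (j : Λ) (a : ℕ → Obs Λ) (y : Obs Λ)
    (m : ℕ) :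
    ∫ ω, (∏ i ∈ Finset.range (m + 1), a i (ω i)) * y (ω (m + 1)) ∂S.pathMeasure j =
      ∫ ω, (∏ i ∈ Finset.range (m + 1), a i (ω i)) * ∑' k, (S.P (ω m) k : ℂ) * y k
        ∂S.pathMeasure j := by
  let G : (Finset.Iic m → Λ) → ℂ := fun z => ∏ i : Finset.Iic m, a i (z i)
  have hm : ∀ x : Obs Λ, Measurable fun i => x i := fun x => .of_discrete
  have hG : Measurable G := Finset.measurable_prod _ fun i _ =>
    (hm (a i)).comp (measurable_pi_apply i)
  have hGω : ∀ ω : ℕ → Λ, ∏ i ∈ Finset.range (m + 1), a i (ω i) =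
      G (Preorder.frestrictLe (π := fun _ => Λ) m ω) := fun ω => by
    rw [Nat.range_succ_eq_Iic]
    exact (Finset.prod_attach (Finset.Iic m) fun i => a i (ω i)).symm
  have hc := Kernel.partialTraj_compProd_eq_map_traj (X := fun _ => Λ) (κ := S.stepKernel)
    (zero_le : 0 ≤ m) (x₀ := fun _ => j)
  have hr := Kernel.traj_map_frestrictLe_apply (X := fun _ => Λ) (κ := S.stepKernel) 0 m
    fun _ => j
  have hmeas : Measurable fun q : (Finset.Iic m → Λ) × Λ => G q.1 * y q.2 :=
    (hG.comp measurable_fst).mul ((hm y).comp measurable_snd)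
  have hstep : Measurable fun i => ∑' k, (S.P i k : ℂ) * y k := .of_discrete
  have hmeas' : Measurable fun z : Finset.Iic m → Λ =>
      G z * ∑' k, (S.P (z ⟨m, Finset.mem_Iic.2 le_rfl⟩) k : ℂ) * y k :=
    hG.mul (hstep.comp (measurable_pi_apply _))
  simp_rw [hGω]
  calc
    _ = ∫ q, G q.1 * y q.2 ∂(S.pathMeasure j).map
        fun ω => (Preorder.frestrictLe (π := fun _ => Λ) m ω, ω (m + 1)) :=
      (integral_map (by fun_prop) hmeas.aestronglyMeasurable).symm
    _ = ∫ z, G z * ∑' k, (S.P (z ⟨m, Finset.mem_Iic.2 le_rfl⟩) k : ℂ) * y k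
        ∂Kernel.partialTraj (X := fun _ => Λ) S.stepKernel 0 m fun _ => j := by
      -- Fubini for the composition product: the last coordinate is integrated first, which turns
      -- `y` into `P y` at the state of time `m`.
      rw [pathMeasure, ← hc, Measure.integral_compProd]
      · refine integral_congr_ae (.of_forall fun z => ?_)
        simp only [integral_const_mul]
        rw [← S.integral_stepPMF]
        rfl
      · refine .of_bound hmeas.aestronglyMeasurable ((∏ i : Finset.Iic m, ‖a i‖) * ‖y‖)
          (.of_forall fun q => ?_)
        rw [norm_mul]
        exact mul_le_mul (norm_prod_obs_le _ (fun i : Finset.Iic m => a i) q.1)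
          (lp.norm_apply_le_norm ENNReal.top_ne_zero y q.2) (norm_nonneg _)
          (Finset.prod_nonneg fun _ _ => norm_nonneg _)
    _ = _ := by
      rw [← hr]
      exact integral_map (by fun_prop) hmeas'.aestronglyMeasurable

end PathMeasure

/-! ### The evolved states -/

/-- The distribution at time `n` of the classical chain started from `ρ`. -/
def law {Λ : Type*} (S : StochasticMatrix Λ) (ρ : InitialState Λ) : ℕ → Λ → ℝ
  | 0 => ρ.weight
  | n + 1 => fun i => ∑' j, S.P j i * S.law ρ n j

theorem evolve_toWalk {Λ : Type*} (S : StochasticMatrix Λ) (U : Λ → Λ → Circle)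
    (ρ : InitialState Λ) (n : ℕ) (i : Λ) : (S.toWalk U).evolve ρ n i = S.law ρ n i := by
  induction n generalizing i with
  | zero => rfl
  | succ n ih =>
    simp only [Walk.evolve, law, ih, Complex.ofReal_tsum]
    refine tsum_congr fun j => ?_
    have h : (S.toWalk U).B i j * conj ((S.toWalk U).B i j) = (S.P j i : ℂ) := by
      change ((Real.sqrt (S.P j i) : ℂ) * (U i j : ℂ)) *
        conj ((Real.sqrt (S.P j i) : ℂ) * (U i j : ℂ)) = _
      rw [Complex.mul_conj, Complex.normSq_mul, Complex.normSq_ofReal,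
        Circle.normSq_coe, Real.mul_self_sqrt (S.nonneg j i), mul_one]
    rw [mul_right_comm, h]
    push_cast
    rfl

theorem law_nonneg {Λ : Type*} (S : StochasticMatrix Λ) (ρ : InitialState Λ) (n : ℕ) (i : Λ) :
    0 ≤ S.law ρ n i := by
  induction n generalizing i with
  | zero => exact ρ.nonneg i
  | succ n ih => exact tsum_nonneg fun j => mul_nonneg (S.nonneg j i) (ih j)

/-- Tonelli: the rows of the double family `P(j,i) · law n j` sum to `law n j`, so the family is
summable, and hence so are its column sums. This feeds the summability needed in `law_succ_ne_zero`.
-/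
theorem summable_law {Λ : Type*} (S : StochasticMatrix Λ) (ρ : InitialState Λ) (n : ℕ) :
    Summable (S.law ρ n) := by
  induction n with
  | zero => exact ρ.hasSum_one.summable
  | succ n ih =>
    have h : Summable fun q : Λ × Λ => S.P q.1 q.2 * S.law ρ n q.1 := by
      have h0 : 0 ≤ fun q : Λ × Λ => S.P q.1 q.2 * S.law ρ n q.1 := fun q =>
        mul_nonneg (S.nonneg _ _) (S.law_nonneg ρ n _)
      refine (summable_prod_of_nonneg h0).2
        ⟨fun j => (S.hasSum_row j).summable.mul_right (S.law ρ n j), ?_⟩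
      simpa only [tsum_mul_right, (S.hasSum_row _).tsum_eq, one_mul] using ih
    exact h.prod_symm.prod

/-- The term coming from `i` is positive and nothing can cancel it. This propagation of supports is
why the cut-offs in the transition expectations are invisible along paths. -/
theorem law_succ_ne_zero {Λ : Type*} (S : StochasticMatrix Λ) (ρ : InitialState Λ) (n : ℕ)
    {i k : Λ} (hi : S.law ρ n i ≠ 0) (hk : 0 < S.P i k) : S.law ρ (n + 1) k ≠ 0 := by
  have hs : Summable fun j => S.P j k * S.law ρ n j :=
    Summable.of_nonneg_of_le (fun j => mul_nonneg (S.nonneg _ _) (S.law_nonneg ρ n _))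
      (fun j => mul_le_of_le_one_left (S.law_nonneg ρ n _) (S.entry_le_one _ _))
      (S.summable_law ρ n)
  exact (hs.tsum_pos (fun j => mul_nonneg (S.nonneg _ _) (S.law_nonneg ρ n _)) i
    (mul_pos hk ((S.law_nonneg ρ n i).lt_of_ne' hi))).ne'

end StochasticMatrix

/-! ### The forward map and reducibility -/

namespace PathAlgebra

variable {Λ : Type*} [MeasurableSpace Λ] [DiscreteMeasurableSpace Λ]

theorem measurable (f : PathAlgebra Λ) : Measurable (f : (ℕ → Λ) → ℂ) := by
  -- `PathAlgebra` is built on the σ-algebra `⊤` of `Λ`, so the ambient discrete one must first be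
  -- identified with it.
  have h : ‹MeasurableSpace Λ› = ⊤ := top_unique fun s _ => MeasurableSet.of_discrete
  subst h
  exact f.2.1

theorem integrable (f : PathAlgebra Λ) (μ : Measure (ℕ → Λ)) [IsFiniteMeasure μ] :
    Integrable (f : (ℕ → Λ) → ℂ) μ := by
  obtain ⟨C, hC⟩ := f.2.2
  exact .of_bound (measurable f).aestronglyMeasurable C (.of_forall hC)

end PathAlgebra

/-- The indicator function of a set of states, as a projection of `𝓑`. -/
def stateIndicator {Λ : Type*} (A : Set Λ) : Obs Λ :=
  ⟨A.indicator 1, memℓp_infty ⟨1, by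
    rintro _ ⟨i, rfl⟩
    by_cases h : i ∈ A <;> simp [h]⟩⟩

theorem stateIndicator_of_mem {Λ : Type*} {A : Set Λ} {i : Λ} (h : i ∈ A) :
    stateIndicator A i = 1 :=
  Set.indicator_of_mem h _

theorem stateIndicator_of_notMem {Λ : Type*} {A : Set Λ} {i : Λ} (h : i ∉ A) :
    stateIndicator A i = 0 :=
  Set.indicator_of_notMem h _

theorem isStarProjection_stateIndicator {Λ : Type*} (A : Set Λ) :
    IsStarProjection (stateIndicator A) where
  isIdempotentElem := by
    ext i
    rw [lp.infty_coeFn_mul, Pi.mul_apply]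
    by_cases h : i ∈ A
    · rw [stateIndicator_of_mem h, one_mul]
    · rw [stateIndicator_of_notMem h, zero_mul]
  isSelfAdjoint := by
    ext i
    rw [lp.star_apply]
    by_cases h : i ∈ A
    · rw [stateIndicator_of_mem h, star_one]
    · rw [stateIndicator_of_notMem h, star_zero]

theorem localTensor_apply {Λ : Type*} (a : ℕ → Obs Λ) (n : ℕ) (ω : ℕ → Λ) :
    (localTensor a n : (ℕ → Λ) → ℂ) ω = ∏ k ∈ Finset.range (n + 1), a k (ω k) := by
  rw [localTensor, coe_prod_path, Finset.prod_apply]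
  rfl

/-! ### Limit elements, path expectations and reducibility -/

namespace StochasticMatrix

/-- The support of the law of the chain at time `n`. -/
def lawSupport {Λ : Type*} (S : StochasticMatrix Λ) (ρ : InitialState Λ) (n : ℕ) : Set Λ :=
  Function.support (S.law ρ n)

theorem expectations_apply_of_mem {Λ : Type*} (S : StochasticMatrix Λ) (U : Λ → Λ → Circle)
    (ρ : InitialState Λ) (n : ℕ) (x y : Obs Λ) {j : Λ} (hj : j ∈ S.lawSupport ρ n) :
    (S.toWalk U).expectations ρ n x y j = x j * ∑' k, (S.P j k : ℂ) * y k := by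
  rw [S.expectations_apply, Set.indicator_of_mem]
  change _ ≠ _
  rw [S.evolve_toWalk]
  exact Complex.ofReal_ne_zero.2 hj

theorem expectations_apply_of_notMem {Λ : Type*} (S : StochasticMatrix Λ) (U : Λ → Λ → Circle)
    (ρ : InitialState Λ) (n : ℕ) (x y : Obs Λ) {j : Λ} (hj : j ∉ S.lawSupport ρ n) :
    (S.toWalk U).expectations ρ n x y j = 0 := by
  rw [S.expectations_apply, Set.indicator_of_notMem]
  intro h
  change _ ≠ _ at h
  rw [S.evolve_toWalk] at h
  exact hj (Complex.ofReal_ne_zero.1 h)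

/-- No mass is lost: successors of positive probability remain in the next support, where the inner
value is one by induction, so only the row sum of `P` remains. -/
theorem nested_one_apply {Λ : Type*} (S : StochasticMatrix Λ) (U : Λ → Λ → Circle)
    (ρ : InitialState Λ) (k n : ℕ) {j : Λ} (hj : j ∈ S.lawSupport ρ n) :
    nested ((S.toWalk U).expectations ρ) (fun _ => 1) 1 n k j = 1 := by
  induction k generalizing n j with
  | zero => rfl
  | succ k ih =>
    have h : ∀ i, (S.P j i : ℂ) *
        nested ((S.toWalk U).expectations ρ) (fun _ => 1) 1 (n + 1) k i = (S.P j i : ℂ) := by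
      intro i
      rcases (S.nonneg j i).eq_or_lt with h0 | h0
      · rw [← h0, Complex.ofReal_zero, zero_mul]
      · rw [ih (n + 1) (S.law_succ_ne_zero ρ n hj h0), mul_one]
    rw [nested, S.expectations_apply_of_mem U ρ n _ _ hj, tsum_congr h, ← Complex.ofReal_tsum,
      (S.hasSum_row j).tsum_eq, Complex.ofReal_one, mul_one]
    rfl

/-- The limit elements are the indicator functions of the supports of the evolved states. -/
theorem isLimitElement_stateIndicator {Λ : Type*} (S : StochasticMatrix Λ) (U : Λ → Λ → Circle)
    (ρ : InitialState Λ) (n : ℕ) :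
    IsLimitElement ((S.toWalk U).expectations ρ) n (stateIndicator (S.lawSupport ρ n)) := by
  intro j
  refine tendsto_const_nhds.congr fun k => ?_
  by_cases hj : j ∈ S.lawSupport ρ n
  · rw [S.nested_one_apply U ρ _ n hj, stateIndicator_of_mem hj]
  -- The depth `k + 1` is at least one, so the outermost cut-off acts; at depth zero the value would
  -- still be one.
  · rw [stateIndicator_of_notMem hj, nested, S.expectations_apply_of_notMem U ρ n _ _ hj]

section ForwardMap

variable {Λ : Type*} [MeasurableSpace Λ] [DiscreteMeasurableSpace Λ]

/-- The conditional expectations given the initial state, restricted to initial states in `A`. -/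
def forwardMap (S : StochasticMatrix Λ) (A : Set Λ) : PathAlgebra Λ →ₗ[ℂ] Obs Λ where
  toFun f := ⟨A.indicator fun j => ∫ ω, (f : (ℕ → Λ) → ℂ) ω ∂S.pathMeasure j, by
    obtain ⟨C, hC⟩ := f.2.2
    refine memℓp_infty ⟨C, ?_⟩
    rintro _ ⟨j, rfl⟩
    refine (norm_indicator_le_norm_self _ _).trans ?_
    simpa using norm_integral_le_of_norm_le_const (μ := S.pathMeasure j) (.of_forall hC)⟩
  map_add' f g := by
    ext j
    change A.indicator (fun j => ∫ ω, (f : (ℕ → Λ) → ℂ) ω + (g : (ℕ → Λ) → ℂ) ω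
      ∂S.pathMeasure j) j = A.indicator (fun j => ∫ ω, (f : (ℕ → Λ) → ℂ) ω ∂S.pathMeasure j) j +
        A.indicator (fun j => ∫ ω, (g : (ℕ → Λ) → ℂ) ω ∂S.pathMeasure j) j
    simp only [integral_add (PathAlgebra.integrable f _) (PathAlgebra.integrable g _),
      Set.indicator_add]
  map_smul' c f := by
    ext j
    change A.indicator (fun j => ∫ ω, c * (f : (ℕ → Λ) → ℂ) ω ∂S.pathMeasure j) j =
      c * A.indicator (fun j => ∫ ω, (f : (ℕ → Λ) → ℂ) ω ∂S.pathMeasure j) j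
    simp only [integral_const_mul, Set.indicator_const_mul]

theorem forwardMap_of_mem (S : StochasticMatrix Λ) {A : Set Λ} (f : PathAlgebra Λ) {j : Λ}
    (hj : j ∈ A) : S.forwardMap A f j = ∫ ω, (f : (ℕ → Λ) → ℂ) ω ∂S.pathMeasure j :=
  Set.indicator_of_mem hj fun j => ∫ ω, (f : (ℕ → Λ) → ℂ) ω ∂S.pathMeasure j

theorem forwardMap_of_notMem (S : StochasticMatrix Λ) {A : Set Λ} (f : PathAlgebra Λ) {j : Λ}
    (hj : j ∉ A) : S.forwardMap A f j = 0 :=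
  Set.indicator_of_notMem hj fun j => ∫ ω, (f : (ℕ → Λ) → ℂ) ω ∂S.pathMeasure j

theorem forwardMap_one_of_mem (S : StochasticMatrix Λ) {A : Set Λ} {j : Λ} (hj : j ∈ A) :
    S.forwardMap A 1 j = 1 := by
  rw [S.forwardMap_of_mem 1 hj]
  change ∫ _, (1 : ℂ) ∂S.pathMeasure j = 1
  simp

variable [Countable Λ]

theorem ae_pathMeasure_mem_lawSupport (S : StochasticMatrix Λ) (ρ : InitialState Λ) {j : Λ}
    (hj : j ∈ S.lawSupport ρ 0) : ∀ᵐ ω ∂S.pathMeasure j, ∀ m, ω m ∈ S.lawSupport ρ m :=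
  S.ae_pathMeasure_mem (fun m _ hi _ => S.law_succ_ne_zero ρ m hi) hj

/-- Nested transition expectations are iterated conditional expectations of the chain. -/
theorem integral_nested (S : StochasticMatrix Λ) (U : Λ → Λ → Circle) (ρ : InitialState Λ)
    (a : ℕ → Obs Λ) (c : Obs Λ) {j : Λ} (hj : j ∈ S.lawSupport ρ 0) (k m : ℕ) :
    ∫ ω, (∏ i ∈ Finset.range m, a i (ω i)) *
        nested ((S.toWalk U).expectations ρ) a c m k (ω m) ∂S.pathMeasure j =
      ∫ ω, (∏ i ∈ Finset.range (m + k), a i (ω i)) * c (ω (m + k)) ∂S.pathMeasure j := by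
  induction k generalizing m with
  | zero => rfl
  | succ k ih =>
    -- The induction hypothesis at `m + 1` restores the `k` inner expectations, and the Markov
    -- property pulls the integrand back to time `m`. There the path lies in the support, so the
    -- remaining factor is the outermost expectation without its cut-off.
    rw [show m + (k + 1) = m + 1 + k by ring, ← ih (m + 1), S.integral_pathMeasure_succ]
    refine integral_congr_ae ?_
    filter_upwards [S.ae_pathMeasure_mem_lawSupport ρ hj] with ω hω
    rw [nested, S.expectations_apply_of_mem U ρ m _ _ (hω m), Finset.prod_range_succ, mul_assoc]

theorem isForwardMap_forwardMap (S : StochasticMatrix Λ) (U : Λ → Λ → Circle)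
    (ρ : InitialState Λ) :
    IsForwardMap ((S.toWalk U).expectations ρ) (S.forwardMap (S.lawSupport ρ 0)) where
  nonneg f hf j := by
    by_cases hj : j ∈ S.lawSupport ρ 0
    · rw [S.forwardMap_of_mem f hj]
      exact integral_nonneg hf
    · rw [S.forwardMap_of_notMem f hj]
  subMarkov j := by
    by_cases hj : j ∈ S.lawSupport ρ 0
    · rw [S.forwardMap_one_of_mem hj]
    · rw [S.forwardMap_of_notMem 1 hj]
      exact zero_le_one
  local_eq := by
    refine ⟨_, S.isLimitElement_stateIndicator U ρ, fun a n => ?_⟩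
    ext j
    by_cases hj : j ∈ S.lawSupport ρ 0
    · rw [S.forwardMap_of_mem _ hj]
      -- Taken at `m = 0`, the left side has no product factor and reduces to the nested element
      -- evaluated at the starting state.
      have h := S.integral_nested U ρ a (stateIndicator (S.lawSupport ρ (n + 1))) hj (n + 1) 0
      simp only [Finset.range_zero, Finset.prod_empty, one_mul, zero_add] at h
      have h0 : ∀ x : Obs Λ, ∫ ω, x (ω 0) ∂S.pathMeasure j = x j := by
        intro x
        rw [integral_congr_ae (g := fun _ => x j), integral_const, probReal_univ, one_smul]
        filter_upwards [S.ae_pathMeasure_zero j] with ω hω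
        rw [hω]
      rw [← h0 (nested _ _ _ _ _), h]
      refine integral_congr_ae ?_
      filter_upwards [S.ae_pathMeasure_mem_lawSupport ρ hj] with ω hω
      -- The closing element `b̄(n+1)` equals one along almost every path, so only the tensor is
      -- left.
      rw [localTensor_apply, stateIndicator_of_mem (hω _), mul_one]
    · rw [S.forwardMap_of_notMem _ hj, nested, S.expectations_apply_of_notMem U ρ 0 _ _ hj]
  limit f g hb hl j := by
    obtain ⟨C, hC⟩ := hb
    by_cases hj : j ∈ S.lawSupport ρ 0
    · simp only [S.forwardMap_of_mem _ hj]
      exact tendsto_integral_of_dominated_convergence (fun _ => C)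
        (fun k => (PathAlgebra.measurable (f k)).aestronglyMeasurable) (integrable_const C)
        (fun k => .of_forall (hC k)) (.of_forall hl)
    · simp only [S.forwardMap_of_notMem _ hj]
      exact tendsto_const_nhds

theorem isMarkovPair_forwardMap (S : StochasticMatrix Λ) (U : Λ → Λ → Circle)
    (ρ : InitialState Λ) :
    IsMarkovPair ρ ((S.toWalk U).expectations ρ) (S.forwardMap (S.lawSupport ρ 0)) := by
  refine ⟨S.isForwardMap_forwardMap U ρ, ?_⟩
  have h : ∀ i, (ρ.weight i : ℂ) * S.forwardMap (S.lawSupport ρ 0) 1 i = (ρ.weight i : ℂ) := by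
    intro i
    by_cases hi : i ∈ S.lawSupport ρ 0
    · rw [S.forwardMap_one_of_mem hi, mul_one]
    · have : ρ.weight i = 0 := Function.notMem_support.1 hi
      rw [this, Complex.ofReal_zero, zero_mul]
  rw [InitialState.eval, tsum_congr h, ← Complex.ofReal_tsum, ρ.hasSum_one.tsum_eq,
    Complex.ofReal_one]

/-- Paths started in `C` almost surely never leave it, so both projections are one under the
integral; starting states outside `A` contribute zero on either side. -/
theorem forwardMap_tailProjection (S : StochasticMatrix Λ) {A C : Set Λ} (hAC : A ⊆ C)
    (hC : S.ForwardClosed C) (a : PathAlgebra Λ) :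
    S.forwardMap A (tailProjection (stateIndicator C) 0 * a * tailProjection (stateIndicator C) 0) =
      S.forwardMap A a := by
  ext j
  by_cases hj : j ∈ A
  · rw [S.forwardMap_of_mem _ hj, S.forwardMap_of_mem _ hj]
    refine integral_congr_ae ?_
    filter_upwards [S.ae_pathMeasure_mem (A := fun _ => C)
      (fun _ i hi k hk => hC i hi k (.of_pos hk)) (hAC hj)] with ω hω
    have h1 : (tailProjection (stateIndicator C) 0 : (ℕ → Λ) → ℂ) ω = 1 :=
      Set.indicator_of_mem (s := {ω : ℕ → Λ | ∀ k, 0 ≤ k → stateIndicator C (ω k) = 1})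
        (fun k _ => stateIndicator_of_mem (hω k)) 1
    change (tailProjection (stateIndicator C) 0 : (ℕ → Λ) → ℂ) ω * (a : (ℕ → Λ) → ℂ) ω *
      (tailProjection (stateIndicator C) 0 : (ℕ → Λ) → ℂ) ω = _
    rw [h1, one_mul, mul_one]
  · rw [S.forwardMap_of_notMem _ hj, S.forwardMap_of_notMem _ hj]

end ForwardMap

theorem isReducibleQMC_of_forwardClosed {Λ : Type*} [Countable Λ] (S : StochasticMatrix Λ)
    {C : Set Λ} (hne : C.Nonempty) (huniv : C ≠ Set.univ) (hC : S.ForwardClosed C)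
    (ρ : InitialState Λ) (hρ : ∀ i, i ∉ C → ρ.weight i = 0) (U : Λ → Λ → Circle) :
    IsReducibleQMC ρ ((S.toWalk U).expectations ρ) := by
  -- The statement carries no σ-algebra on `Λ`; the discrete one is supplied here for the path
  -- measure.
  let _ : MeasurableSpace Λ := ⊤
  refine ⟨_, S.isMarkovPair_forwardMap U ρ, stateIndicator C, 0,
    isStarProjection_stateIndicator C, fun h => ?_, fun h => ?_,
    S.forwardMap_tailProjection (fun i hi => not_not.1 fun h => hi (hρ i h)) hC⟩
  · obtain ⟨i, hi⟩ := hne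
    have := congrArg (fun x : Obs Λ => x i) h
    exact one_ne_zero ((stateIndicator_of_mem hi).symm.trans this)
  · obtain ⟨i, hi⟩ := (Set.ne_univ_iff_exists_notMem C).1 huniv
    have := congrArg (fun x : Obs Λ => x i) h
    exact zero_ne_one ((stateIndicator_of_notMem hi).symm.trans this)

end StochasticMatrix

/-- The initial state concentrated at a point. -/
def InitialState.single {Λ : Type*} (i : Λ) : InitialState Λ where
  weight := Set.indicator {i} 1
  nonneg := Set.indicator_nonneg fun _ _ => zero_le_one
  hasSum_one := by
    have h := hasSum_single (f := Set.indicator {i} (1 : Λ → ℝ)) i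
      fun j hj => Set.indicator_of_notMem (s := {i}) hj 1
    simpa using h

end OQRW

end

theorem mainTheorem8 {Λ : Type*} [Countable Λ] (S : OQRW.StochasticMatrix Λ)
    (hS : S.Reducible) :
    (∃ C : Set Λ, C.Nonempty ∧ C ≠ Set.univ ∧ S.ForwardClosed C ∧
      ∃ ρ : OQRW.InitialState Λ, (∀ i, i ∉ C → ρ.weight i = 0) ∧
        ∀ U : Λ → Λ → Circle, OQRW.IsReducibleQMC ρ ((S.toWalk U).expectations ρ)) ∧
    (∀ C : Set Λ, C.Nonempty → C ≠ Set.univ → S.ForwardClosed C →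
      ∀ ρ : OQRW.InitialState Λ, (∀ i, i ∉ C → ρ.weight i = 0) →
        ∀ U : Λ → Λ → Circle, OQRW.IsReducibleQMC ρ ((S.toWalk U).expectations ρ)) := by
  refine ⟨?_, fun C hne hu hC ρ hρ U => S.isReducibleQMC_of_forwardClosed hne hu hC ρ hρ U⟩
  obtain ⟨C, hne, hu, hC⟩ := hS.exists_forwardClosed
  obtain ⟨i, hi⟩ := id hne
  have hρ : ∀ j, j ∉ C → (OQRW.InitialState.single i).weight j = 0 := fun j hj =>
    Set.indicator_of_notMem (fun h : j ∈ ({i} : Set Λ) => hj (h ▸ hi)) _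
  exact ⟨C, hne, hu, hC, _, hρ, fun U => S.isReducibleQMC_of_forwardClosed hne hu hC _ hρ U⟩
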